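/- Let $\mathbb{K}\in\{\mathbb{R},\mathbb{C}\}$, let $X=(\Omega,\Sigma,\mu)$ be a complete $\sigma$-finite measure space, let $G$ be a (discrete) group, $S\subset G$ a submonoid, and let $\varphi\colon g\mapsto\varphi_g$ be a homomorphism from $G$ to the group of automorphisms of $X$ (measure-preserving maps, modulo equality almost everywhere). Let $T_\varphi(g)f=f\circ\varphi_g^{-1}$ be the Koopman representation of $G$ on the Banach algebra $\mathrm{L}^\infty(X)$. A *measurable Banach bundle* $E$ over $X$ is a family of Banach spaces $(E_x)_{x\in\Omega}$ over $\mathbb{K}$ with a linear space $\mathcal{M}_E$ of sections $s$, $s(x)\in E_x$ (the measurable sections), such that $fs\in\mathcal{M}_E$ for measurable $f\colon\Omega\to\mathbb{K}$ and $s\in\mathcal{M}_E$, such that $|s|\colon x\mapsto\|s(x)\|$ is measurable for $s\in\mathcal{M}_E$, and such that every section which is an almost everywhere limit of a sequence in $\mathcal{M}_E$ belongs to $\mathcal{M}_E$. It is *separable* if there are $s_n\in\mathcal{M}_E$ $(n\in\mathbb{N})$ such that the linear span of $\{s_n(x)\mid n\in\mathbb{N}\}$ is dense in $E_x$ for almost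 every $x$. Let $\Gamma^1(E)$ be the Banach module over $\mathrm{L}^\infty(X)$ of all $s\in\mathcal{M}_E$ with $\|s\|:=\int_X|s|\,\mathrm{d}\mu<\infty$, modulo equality almost everywhere. A *morphism* of $E$ over $\varphi_g$ is given by a map $\Phi$ of the total space $\bigsqcup_x E_x$ to itself such that for almost every $x$ it restricts to a bounded linear operator $\Phi|_{E_x}\colon E_x\to E_{\varphi_g(x)}$, such that $\operatorname{ess\,sup}_x\|\Phi|_{E_x}\|<\infty$, and such that for each $s\in\mathcal{M}_E$ there is $t\in\mathcal{M}_E$ with $\Phi\circ s=t\circ\varphi_g$ almost everywhere; two such maps are identified if they agree on almost every fiber. An *$S$-dynamical Banach bundle* $(E;\Phi)$ over $(X;\varphi)$ is a family of morphisms $\Phi_g$ of $E$ over $\varphi_g$ $(g\in S)$ with $\Phi_1=\mathrm{Id}_E$ and $\Phi_g\circ\Phi_h=\Phi_{gh}$ for all $g,h\in S$. Its *weighted Koopman representation* $\mathcal{T}_\Phi\colon S\to\mathscr{L}(\Gamma^1(E))$ is $\mathcal{T}_\Phi(g)s=\Phi_g\circ s\circ\varphi_g^{-1}$. Let $E$ be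 a separable measurable Banach bundle over $X$ and let $\mathcal{T}\colon S\to\mathscr{L}(\Gamma^1(E))$ be a monoid homomorphism making $\Gamma^1(E)$ an $S$-dynamical Banach module over $(\mathrm{L}^\infty(X);T_\varphi)$, i.e. $\mathcal{T}(g)(fs)=T_\varphi(g)f\cdot\mathcal{T}(g)s$ for all $g\in S$, $f\in\mathrm{L}^\infty(X)$ and $s\in\Gamma^1(E)$. Then there is a unique $S$-dynamical Banach bundle $(E;\Phi)$ over $(X;\varphi)$, with underlying bundle $E$, such that $\mathcal{T}_\Phi=\mathcal{T}$. -/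

import Mathlib

open MeasureTheory Filter Topology
open scoped ENNReal

noncomputable section

/-! ### The commutative Banach algebra `L^∞(X)` -/

namespace LInfty

variable {Ω 𝕜 : Type*} [RCLike 𝕜] [MeasurableSpace Ω] {μ : Measure Ω}

instance instMul : Mul (Lp 𝕜 ∞ μ) where
  mul f g := ⟨(f : Ω →ₘ[μ] 𝕜) * (g : Ω →ₘ[μ] 𝕜), by
    rw [Lp.mem_Lp_iff_memLp]
    exact ((Lp.memLp g).mul (r := ∞) (Lp.memLp f)).ae_eq (AEEqFun.coeFn_mul _ _).symm⟩

instance instOne : One (Lp 𝕜 ∞ μ) where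
  one := ⟨(1 : Ω →ₘ[μ] 𝕜), by
    rw [Lp.mem_Lp_iff_memLp]
    exact (memLp_top_const (1 : 𝕜)).ae_eq AEEqFun.coeFn_one.symm⟩

theorem val_mul (f g : Lp 𝕜 ∞ μ) :
    ((f * g : Lp 𝕜 ∞ μ) : Ω →ₘ[μ] 𝕜) = (f : Ω →ₘ[μ] 𝕜) * (g : Ω →ₘ[μ] 𝕜) := rfl

theorem val_one : ((1 : Lp 𝕜 ∞ μ) : Ω →ₘ[μ] 𝕜) = 1 := rfl

theorem coeFn_mul (f g : Lp 𝕜 ∞ μ) : ∀ᵐ x ∂μ, (f * g : Lp 𝕜 ∞ μ) x = f x * g x :=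
  AEEqFun.coeFn_mul _ _

theorem coeFn_one : ∀ᵐ x ∂μ, (1 : Lp 𝕜 ∞ μ) x = 1 := AEEqFun.coeFn_one

theorem ae_norm_le (f : Lp 𝕜 ∞ μ) : ∀ᵐ x ∂μ, ‖f x‖ ≤ ‖f‖ := by
  have h := ae_le_eLpNormEssSup (f := (f : Ω → 𝕜)) (μ := μ)
  filter_upwards [h] with x hx
  rw [Lp.norm_def, eLpNorm_exponent_top, ← toReal_enorm]
  exact ENNReal.toReal_mono (by simpa using Lp.eLpNorm_ne_top f) hx

theorem norm_le_of_ae {f : Lp 𝕜 ∞ μ} {C : ℝ} (hC : 0 ≤ C) (h : ∀ᵐ x ∂μ, ‖f x‖ ≤ C) :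
    ‖f‖ ≤ C := by
  rw [Lp.norm_def, eLpNorm_exponent_top]
  exact ENNReal.toReal_le_of_le_ofReal hC (eLpNormEssSup_le_of_ae_bound h)

/-- `L^∞(X)` with pointwise (almost everywhere) multiplication. -/
instance instNormedCommRing : NormedCommRing (Lp 𝕜 ∞ μ) where
  __ := (inferInstance : NormedAddCommGroup (Lp 𝕜 ∞ μ))
  mul := (· * ·)
  one := 1
  left_distrib f g h := Lp.ext <| by
    filter_upwards [coeFn_mul f (g + h), coeFn_mul f g, coeFn_mul f h, Lp.coeFn_add g h,
      Lp.coeFn_add (f * g) (f * h)] with x h1 h2 h3 h4 h5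
    exact h1.trans (by rw [h5, h4, Pi.add_apply, Pi.add_apply, h2, h3, mul_add])
  right_distrib f g h := Lp.ext <| by
    filter_upwards [coeFn_mul (f + g) h, coeFn_mul f h, coeFn_mul g h, Lp.coeFn_add f g,
      Lp.coeFn_add (f * h) (g * h)] with x h1 h2 h3 h4 h5
    exact h1.trans (by rw [h5, h4, Pi.add_apply, Pi.add_apply, h2, h3, add_mul])
  zero_mul f := Lp.ext <| by
    filter_upwards [coeFn_mul 0 f, Lp.coeFn_zero 𝕜 ∞ μ] with x h1 h2
    exact h1.trans (by rw [h2, Pi.zero_apply, zero_mul])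
  mul_zero f := Lp.ext <| by
    filter_upwards [coeFn_mul f 0, Lp.coeFn_zero 𝕜 ∞ μ] with x h1 h2
    exact h1.trans (by rw [h2, Pi.zero_apply, mul_zero])
  mul_assoc f g h := Subtype.ext (mul_assoc (f : Ω →ₘ[μ] 𝕜) g h)
  one_mul f := Subtype.ext (one_mul (f : Ω →ₘ[μ] 𝕜))
  mul_one f := Subtype.ext (mul_one (f : Ω →ₘ[μ] 𝕜))
  mul_comm f g := Subtype.ext (mul_comm (f : Ω →ₘ[μ] 𝕜) g)
  norm_mul_le f g := by
    refine norm_le_of_ae (by positivity) ?_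
    filter_upwards [coeFn_mul f g, ae_norm_le f, ae_norm_le g] with x h hf hg
    rw [h, norm_mul]
    gcongr

instance instNormedAlgebra : NormedAlgebra 𝕜 (Lp 𝕜 ∞ μ) where
  __ := Algebra.ofModule (R := 𝕜) (A := Lp 𝕜 ∞ μ)
    (fun c f g => Lp.ext <| by
      filter_upwards [coeFn_mul (c • f) g, coeFn_mul f g, Lp.coeFn_smul c f,
        Lp.coeFn_smul c (f * g)] with x h1 h2 h3 h4
      rw [h1, h3, h4, Pi.smul_apply, Pi.smul_apply, h2, smul_mul_assoc])
    (fun c f g => Lp.ext <| by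
      filter_upwards [coeFn_mul f (c • g), coeFn_mul f g, Lp.coeFn_smul c g,
        Lp.coeFn_smul c (f * g)] with x h1 h2 h3 h4
      rw [h1, h3, h4, Pi.smul_apply, Pi.smul_apply, h2, mul_smul_comm])
  norm_smul_le c f := norm_smul_le c f

end LInfty

/-! ### Measurable Banach bundles -/

section Bundle

variable {Ω 𝕜 : Type*} [RCLike 𝕜] [MeasurableSpace Ω]

/-- A measurable Banach bundle over `(Ω, μ)` with fibers `E x`. The total space is `Σ x, E x` with
the first projection, and sections are the elements of `∀ x, E x`. -/
structure MeasurableBanachBundle (𝕜 : Type*) [RCLike 𝕜] {Ω : Type*} [MeasurableSpace Ω]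
    (μ : Measure Ω) (E : Ω → Type*) [∀ x, NormedAddCommGroup (E x)]
    [∀ x, NormedSpace 𝕜 (E x)] [∀ x, CompleteSpace (E x)] where
  /-- the space of measurable sections -/
  measurableSections : Submodule 𝕜 (∀ x, E x)
  smul_mem : ∀ f : Ω → 𝕜, Measurable f → ∀ s ∈ measurableSections,
    (fun x => f x • s x) ∈ measurableSections
  measurable_norm : ∀ s ∈ measurableSections, Measurable fun x => ‖s x‖
  mem_of_tendsto : ∀ (u : ℕ → ∀ x, E x) (s : ∀ x, E x), (∀ n, u n ∈ measurableSections) →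
    (∀ᵐ x ∂μ, Tendsto (fun n => u n x) atTop (𝓝 (s x))) → s ∈ measurableSections

namespace MeasurableBanachBundle

variable {μ : Measure Ω} {E : Ω → Type*} [∀ x, NormedAddCommGroup (E x)]
  [∀ x, NormedSpace 𝕜 (E x)] [∀ x, CompleteSpace (E x)]

/-- The bundle is separable: there is a sequence of measurable sections whose values span a dense
subspace of almost every fiber. -/
def IsSeparable (𝓔 : MeasurableBanachBundle 𝕜 μ E) : Prop :=
  ∃ u : ℕ → ∀ x, E x, (∀ n, u n ∈ 𝓔.measurableSections) ∧
    ∀ᵐ x ∂μ, Dense (Submodule.span 𝕜 (Set.range fun n => u n x) : Set (E x))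

theorem mem_congr (𝓔 : MeasurableBanachBundle 𝕜 μ E) {s t : ∀ x, E x}
    (ht : t ∈ 𝓔.measurableSections) (h : ∀ᵐ x ∂μ, s x = t x) : s ∈ 𝓔.measurableSections :=
  𝓔.mem_of_tendsto (fun _ => t) s (fun _ => ht) <| by
    filter_upwards [h] with x hx
    rw [hx]
    exact tendsto_const_nhds

/-- The measurable sections `s` for which `|s|` is integrable. -/
def integrableSections (𝓔 : MeasurableBanachBundle 𝕜 μ E) : Submodule 𝕜 (∀ x, E x) where
  carrier := {s | s ∈ 𝓔.measurableSections ∧ Integrable (fun x => ‖s x‖) μ}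
  add_mem' {s t} hs ht := ⟨add_mem hs.1 ht.1, (hs.2.add ht.2).mono
    (𝓔.measurable_norm _ (add_mem hs.1 ht.1)).aestronglyMeasurable <| .of_forall fun x => by
      rw [norm_norm]
      exact (norm_add_le _ _).trans (le_abs_self _)⟩
  zero_mem' := ⟨zero_mem _, by simp⟩
  smul_mem' c s hs := ⟨Submodule.smul_mem _ c hs.1, by
    simpa only [Pi.smul_apply, norm_smul] using hs.2.const_mul ‖c‖⟩

/-- The seminormed space of integrable measurable sections (before identifying sections that agree
almost everywhere). -/
def IntegrableSection (𝓔 : MeasurableBanachBundle 𝕜 μ E) : Type _ := 𝓔.integrableSections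

variable {𝓔 : MeasurableBanachBundle 𝕜 μ E}

namespace IntegrableSection

instance instAddCommGroup : AddCommGroup 𝓔.IntegrableSection :=
  inferInstanceAs (AddCommGroup 𝓔.integrableSections)

instance instModule : Module 𝕜 𝓔.IntegrableSection :=
  inferInstanceAs (Module 𝕜 𝓔.integrableSections)

/-- The underlying section. -/
def val (s : 𝓔.IntegrableSection) : ∀ x, E x :=
  Subtype.val (show 𝓔.integrableSections from s)

instance instCoeFun : CoeFun 𝓔.IntegrableSection (fun _ => ∀ x, E x) := ⟨val⟩

/-- An integrable measurable section as an element of the seminormed space. -/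
def of (s : ∀ x, E x) (hs : s ∈ 𝓔.measurableSections) (hi : Integrable (fun x => ‖s x‖) μ) :
    𝓔.IntegrableSection :=
  show 𝓔.integrableSections from ⟨s, hs, hi⟩

theorem of_apply (s : ∀ x, E x) (hs : s ∈ 𝓔.measurableSections)
    (hi : Integrable (fun x => ‖s x‖) μ) (x : Ω) : of s hs hi x = s x := rfl

theorem ext {s t : 𝓔.IntegrableSection} (h : ∀ x, s x = t x) : s = t :=
  Subtype.ext (funext h)

theorem mem (s : 𝓔.IntegrableSection) : s.val ∈ 𝓔.measurableSections :=
  (show 𝓔.integrableSections from s).2.1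

theorem integrable (s : 𝓔.IntegrableSection) : Integrable (fun x => ‖s x‖) μ :=
  (show 𝓔.integrableSections from s).2.2

theorem add_apply (s t : 𝓔.IntegrableSection) (x : Ω) : (s + t) x = s x + t x := rfl

theorem sub_apply (s t : 𝓔.IntegrableSection) (x : Ω) : (s - t) x = s x - t x := rfl

theorem smul_apply (c : 𝕜) (s : 𝓔.IntegrableSection) (x : Ω) : (c • s) x = c • s x := rfl

/-- The norm `‖s‖ = ∫ |s| dμ`. -/
instance instNorm : Norm 𝓔.IntegrableSection := ⟨fun s => ∫ x, ‖s x‖ ∂μ⟩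

theorem norm_def (s : 𝓔.IntegrableSection) : ‖s‖ = ∫ x, ‖s x‖ ∂μ := rfl

theorem core : SeminormedSpace.Core 𝕜 𝓔.IntegrableSection where
  norm_nonneg s := integral_nonneg fun x => norm_nonneg _
  norm_smul c s := by
    simp only [norm_def, smul_apply, norm_smul, integral_const_mul]
  norm_triangle s t := by
    simp only [norm_def]
    rw [← integral_add s.integrable t.integrable]
    exact integral_mono (s + t).integrable (s.integrable.add t.integrable)
      fun x => norm_add_le _ _

instance instSeminormedAddCommGroup : SeminormedAddCommGroup 𝓔.IntegrableSection :=
  SeminormedAddCommGroup.ofCore (core (𝓔 := 𝓔))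

instance instNormedSpace : NormedSpace 𝕜 𝓔.IntegrableSection where
  norm_smul_le c s := (core (𝓔 := 𝓔)).norm_smul c s |>.le

theorem lintegral_enorm_sub (s t : 𝓔.IntegrableSection) :
    ∫⁻ x, ‖s x - t x‖ₑ ∂μ = ENNReal.ofReal (dist s t) := by
  rw [dist_eq_norm, norm_def, ofReal_integral_eq_lintegral_ofReal (s - t).integrable
    (.of_forall fun x => norm_nonneg _)]
  simp only [ofReal_norm, sub_apply]

instance instCompleteSpace : CompleteSpace 𝓔.IntegrableSection := by
  refine Metric.complete_of_convergent_controlled_sequences (fun n => (1 / 2 : ℝ) ^ n)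
    (fun n => by positivity) fun u hu => ?_
  have hm : ∀ m n, AEMeasurable (fun x => ‖u m x - u n x‖ₑ) μ := fun m n => by
    have := (𝓔.measurable_norm _ (u m - u n).mem).enorm.aemeasurable (μ := μ)
    simp only [enorm_norm] at this
    exact this
  have hlt : ∀ᵐ x ∂μ, ∑' n, ‖u (n + 1) x - u n x‖ₑ < ∞ := by
    refine ae_lt_top' (.tsum fun n => hm _ _) ?_
    rw [lintegral_tsum fun n => hm _ _]
    refine ne_top_of_le_ne_top (b := ∑' n, ENNReal.ofReal ((1 / 2 : ℝ) ^ n)) ?_ ?_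
    · exact summable_geometric_two.tsum_ofReal_ne_top
    · refine ENNReal.tsum_le_tsum fun n => ?_
      rw [lintegral_enorm_sub]
      exact ENNReal.ofReal_le_ofReal (hu n _ _ n.le_succ le_rfl).le
  have hlim : ∀ᵐ x ∂μ, ∃ l : E x, Tendsto (fun n => u n x) atTop (𝓝 l) := by
    filter_upwards [hlt] with x hx
    refine cauchySeq_tendsto_of_complete (cauchySeq_of_summable_dist ?_)
    have := ENNReal.summable_toReal hx.ne
    refine this.congr fun n => ?_
    rw [dist_comm, dist_eq_norm, toReal_enorm]
  classical
  let s : ∀ x, E x := fun x =>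
    if h : ∃ l : E x, Tendsto (fun n => u n x) atTop (𝓝 l) then h.choose else 0
  have hs : ∀ᵐ x ∂μ, Tendsto (fun n => u n x) atTop (𝓝 (s x)) := by
    filter_upwards [hlim] with x hx
    simp only [s, dif_pos hx]
    exact hx.choose_spec
  have hsm : s ∈ 𝓔.measurableSections :=
    𝓔.mem_of_tendsto (fun n => u n) s (fun n => (u n).mem) hs
  have hdist : ∀ n, ∫⁻ x, ‖s x - u n x‖ₑ ∂μ ≤ ENNReal.ofReal ((1 / 2 : ℝ) ^ n) := fun n => by
    calc ∫⁻ x, ‖s x - u n x‖ₑ ∂μ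
        = ∫⁻ x, liminf (fun m => ‖u m x - u n x‖ₑ) atTop ∂μ := by
          refine lintegral_congr_ae ?_
          filter_upwards [hs] with x hx
          exact ((hx.sub_const _).enorm.liminf_eq).symm
      _ ≤ liminf (fun m => ∫⁻ x, ‖u m x - u n x‖ₑ ∂μ) atTop :=
          lintegral_liminf_le' fun m => hm m n
      _ ≤ _ := by
          refine liminf_le_of_le (by isBoundedDefault) fun b hb => ?_
          obtain ⟨m, hb, hm⟩ := (hb.and (eventually_ge_atTop n)).exists
          refine hb.trans ?_
          rw [lintegral_enorm_sub]
          exact ENNReal.ofReal_le_ofReal (hu n _ _ hm le_rfl).le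
  have hint : ∀ n, Integrable (fun x => ‖s x - u n x‖) μ := fun n =>
    ⟨(𝓔.measurable_norm _ (sub_mem hsm (u n).mem)).aestronglyMeasurable, by
      rw [HasFiniteIntegral]
      simp only [enorm_norm]
      exact (hdist n).trans_lt ENNReal.ofReal_lt_top⟩
  let d : ∀ n, 𝓔.IntegrableSection := fun n => of (fun x => s x - u n x) (sub_mem hsm (u n).mem) (hint n)
  have hd : ∀ n, u n + d n = u 0 + d 0 := fun n =>
    ext fun x => by simp only [add_apply, d, of_apply, add_sub_cancel]
  refine ⟨u 0 + d 0, tendsto_iff_dist_tendsto_zero.2 <| squeeze_zero (fun n => dist_nonneg)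
    (fun n => ?_) (tendsto_pow_atTop_nhds_zero_of_lt_one (r := (1 / 2 : ℝ)) (by norm_num)
      (by norm_num))⟩
  have h := hdist n
  have h' : dist (u n) (u 0 + d 0) = ∫ x, ‖s x - u n x‖ ∂μ := by
    rw [← hd n, dist_self_add_right, norm_def]
    rfl
  rw [h', ← ENNReal.ofReal_le_ofReal_iff (by positivity),
    ofReal_integral_eq_lintegral_ofReal (hint n) (.of_forall fun x => norm_nonneg _)]
  simpa only [ofReal_norm] using h

end IntegrableSection

/-- `Γ¹(E)`: integrable measurable sections modulo equality almost everywhere, with the norm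
`‖s‖ = ∫ |s| dμ`. -/
abbrev GammaOne (𝓔 : MeasurableBanachBundle 𝕜 μ E) : Type _ :=
  SeparationQuotient 𝓔.IntegrableSection

namespace GammaOne

/-- The class in `Γ¹(E)` of an integrable measurable section. -/
abbrev mk (s : 𝓔.IntegrableSection) : 𝓔.GammaOne := SeparationQuotient.mk s

theorem mk_eq_mk {s t : 𝓔.IntegrableSection} : mk s = mk t ↔ ∀ᵐ x ∂μ, s x = t x := by
  rw [SeparationQuotient.mk_eq_mk, Metric.inseparable_iff, dist_eq_norm,
    IntegrableSection.norm_def,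
    integral_eq_zero_iff_of_nonneg (fun x => norm_nonneg _) (s - t).integrable]
  refine eventually_congr (.of_forall fun x => ?_)
  rw [Pi.zero_apply, norm_eq_zero, IntegrableSection.sub_apply, sub_eq_zero]

theorem norm_mk (s : 𝓔.IntegrableSection) : ‖mk s‖ = ∫ x, ‖s x‖ ∂μ := rfl

theorem mk_add (s t : 𝓔.IntegrableSection) : mk (s + t) = mk s + mk t := rfl

/-- The product `f s` of a bounded measurable function and an integrable section. -/
def smulSection (f : Lp 𝕜 ∞ μ) (s : 𝓔.IntegrableSection) : 𝓔.IntegrableSection :=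
  .of (fun x => f x • s x) (𝓔.smul_mem f (Lp.stronglyMeasurable f).measurable s s.mem) <| by
    refine (s.integrable.const_mul ‖f‖).mono (𝓔.measurable_norm _ (𝓔.smul_mem f
      (Lp.stronglyMeasurable f).measurable s s.mem)).aestronglyMeasurable ?_
    filter_upwards [LInfty.ae_norm_le f] with x hx
    rw [norm_norm, norm_smul]
    exact (mul_le_mul_of_nonneg_right hx (norm_nonneg _)).trans (le_abs_self _)

theorem smulSection_apply (f : Lp 𝕜 ∞ μ) (s : 𝓔.IntegrableSection) (x : Ω) :
    smulSection f s x = f x • s x := rfl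

/-- The action of `L^∞(X)` on `Γ¹(E)`, `(f s)(x) = f(x) s(x)`. -/
instance instSMul : SMul (Lp 𝕜 ∞ μ) 𝓔.GammaOne where
  smul f := SeparationQuotient.lift (fun s => mk (smulSection f s)) fun s t h => by
    have h' := mk_eq_mk.1 (SeparationQuotient.mk_eq_mk.2 h)
    refine mk_eq_mk.2 ?_
    filter_upwards [h'] with x hx
    rw [smulSection_apply, smulSection_apply, hx]

theorem smul_mk (f : Lp 𝕜 ∞ μ) (s : 𝓔.IntegrableSection) : f • mk s = mk (smulSection f s) := rfl

instance instModule : Module (Lp 𝕜 ∞ μ) 𝓔.GammaOne where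
  one_smul s := by
    obtain ⟨s, rfl⟩ := SeparationQuotient.surjective_mk s
    refine mk_eq_mk.2 ?_
    filter_upwards [LInfty.coeFn_one (𝕜 := 𝕜) (μ := μ)] with x hx
    rw [smulSection_apply, hx, one_smul]
  mul_smul f g s := by
    obtain ⟨s, rfl⟩ := SeparationQuotient.surjective_mk s
    refine mk_eq_mk.2 ?_
    filter_upwards [LInfty.coeFn_mul f g] with x hx
    rw [smulSection_apply, hx, mul_smul]
    rfl
  smul_zero f := by
    refine mk_eq_mk.2 (.of_forall fun x => ?_)
    exact smul_zero (f x)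
  smul_add f s t := by
    obtain ⟨s, rfl⟩ := SeparationQuotient.surjective_mk s
    obtain ⟨t, rfl⟩ := SeparationQuotient.surjective_mk t
    exact mk_eq_mk.2 (.of_forall fun x => smul_add (f x) (s x) (t x))
  add_smul f g s := by
    obtain ⟨s, rfl⟩ := SeparationQuotient.surjective_mk s
    refine mk_eq_mk.2 ?_
    filter_upwards [Lp.coeFn_add f g] with x hx
    rw [smulSection_apply, hx, Pi.add_apply, add_smul]
    rfl
  zero_smul s := by
    obtain ⟨s, rfl⟩ := SeparationQuotient.surjective_mk s
    refine mk_eq_mk.2 ?_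
    filter_upwards [Lp.coeFn_zero 𝕜 ∞ μ] with x hx
    rw [smulSection_apply, hx, Pi.zero_apply, zero_smul]
    rfl

instance instIsScalarTower : IsScalarTower 𝕜 (Lp 𝕜 ∞ μ) 𝓔.GammaOne where
  smul_assoc c f s := by
    obtain ⟨s, rfl⟩ := SeparationQuotient.surjective_mk s
    refine mk_eq_mk.2 ?_
    filter_upwards [Lp.coeFn_smul c f] with x hx
    rw [smulSection_apply, hx, Pi.smul_apply, smul_assoc]
    rfl

instance instIsBoundedSMul : IsBoundedSMul (Lp 𝕜 ∞ μ) 𝓔.GammaOne :=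
  .of_norm_smul_le fun f s => by
    obtain ⟨s, rfl⟩ := SeparationQuotient.surjective_mk s
    rw [smul_mk, norm_mk, norm_mk, ← integral_const_mul]
    refine integral_mono_ae (smulSection f s).integrable (s.integrable.const_mul _) ?_
    filter_upwards [LInfty.ae_norm_le f] with x hx
    rw [smulSection_apply, norm_smul]
    exact mul_le_mul_of_nonneg_right hx (norm_nonneg _)

end GammaOne

end MeasurableBanachBundle

end Bundle

/-! ### Measure-preserving systems and Koopman representations -/

section Dynamics

/-- A measure-preserving `G`-dynamical system on `(Ω, μ)`: a homomorphism from `G` to the group of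
automorphisms of `(Ω, μ)`, where measure-preserving maps are identified when they agree almost
everywhere. A representative `φ g` of each automorphism is recorded. -/
structure MeasurePreservingSystem (G : Type*) [Group G] {Ω : Type*} [MeasurableSpace Ω]
    (μ : Measure Ω) where
  /-- the transformation attached to a group element -/
  toFun : G → Ω → Ω
  measurePreserving : ∀ g, MeasurePreserving (toFun g) μ μ
  map_one : ∀ᵐ x ∂μ, toFun 1 x = x
  map_mul : ∀ g h, ∀ᵐ x ∂μ, toFun (g * h) x = toFun g (toFun h x)

namespace MeasurePreservingSystem

variable {G Ω : Type*} [Group G] [MeasurableSpace Ω] {μ : Measure Ω}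

instance instCoeFun : CoeFun (MeasurePreservingSystem G μ) (fun _ => G → Ω → Ω) := ⟨toFun⟩

theorem apply_inv (φ : MeasurePreservingSystem G μ) (g : G) : ∀ᵐ x ∂μ, φ g (φ g⁻¹ x) = x := by
  filter_upwards [φ.map_mul g g⁻¹, φ.map_one] with x h h1
  rw [← h, mul_inv_cancel, h1]

/-- The Koopman representation of `G` on `L^∞(X)`, `T_φ(g) f = f ∘ φ_g⁻¹`. -/
def koopman (𝕜 : Type*) [RCLike 𝕜] (φ : MeasurePreservingSystem G μ) :
    G →* (Lp 𝕜 ∞ μ →ₐ[𝕜] Lp 𝕜 ∞ μ) where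
  toFun g := AlgHom.ofLinearMap
    (Lp.compMeasurePreservingₗ 𝕜 (φ g⁻¹) (φ.measurePreserving g⁻¹))
    (Lp.ext <| by
      filter_upwards [Lp.coeFn_compMeasurePreserving (1 : Lp 𝕜 ∞ μ) (φ.measurePreserving g⁻¹),
        LInfty.coeFn_one (𝕜 := 𝕜) (μ := μ),
        (φ.measurePreserving g⁻¹).quasiMeasurePreserving.ae (LInfty.coeFn_one (𝕜 := 𝕜) (μ := μ))]
        with x h1 h2 h3
      exact h1.trans (h3.trans h2.symm))
    (fun f f' => Lp.ext <| by
      filter_upwards [Lp.coeFn_compMeasurePreserving (f * f') (φ.measurePreserving g⁻¹),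
        Lp.coeFn_compMeasurePreserving f (φ.measurePreserving g⁻¹),
        Lp.coeFn_compMeasurePreserving f' (φ.measurePreserving g⁻¹),
        LInfty.coeFn_mul (Lp.compMeasurePreserving (φ g⁻¹) (φ.measurePreserving g⁻¹) f)
          (Lp.compMeasurePreserving (φ g⁻¹) (φ.measurePreserving g⁻¹) f'),
        (φ.measurePreserving g⁻¹).quasiMeasurePreserving.ae (LInfty.coeFn_mul f f')]
        with x h1 h2 h3 h4 h5
      refine h1.trans (h5.trans (.trans ?_ h4.symm))
      rw [h2, h3]
      rfl)
  map_one' := by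
    refine AlgHom.ext fun f => Lp.ext ?_
    filter_upwards [Lp.coeFn_compMeasurePreserving f (φ.measurePreserving 1⁻¹), φ.map_one]
      with x h1 h2
    rw [← inv_one] at h2
    refine h1.trans ?_
    rw [Function.comp_apply, h2]
    rfl
  map_mul' g h := by
    refine AlgHom.ext fun f => Lp.ext ?_
    filter_upwards [Lp.coeFn_compMeasurePreserving f (φ.measurePreserving (g * h)⁻¹),
      Lp.coeFn_compMeasurePreserving (Lp.compMeasurePreserving _ (φ.measurePreserving h⁻¹) f)
        (φ.measurePreserving g⁻¹),
      (φ.measurePreserving g⁻¹).quasiMeasurePreserving.ae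
        (Lp.coeFn_compMeasurePreserving f (φ.measurePreserving h⁻¹)),
      φ.map_mul h⁻¹ g⁻¹] with x h1 h2 h3 h4
    rw [← mul_inv_rev] at h4
    refine h1.trans (.trans ?_ (h2.trans h3).symm)
    rw [Function.comp_apply, Function.comp_apply, h4]

theorem koopman_apply {𝕜 : Type*} [RCLike 𝕜] (φ : MeasurePreservingSystem G μ) (g : G)
    (f : Lp 𝕜 ∞ μ) : ∀ᵐ x ∂μ, φ.koopman 𝕜 g f x = f (φ g⁻¹ x) :=
  Lp.coeFn_compMeasurePreserving f (φ.measurePreserving g⁻¹)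

end MeasurePreservingSystem

/-- Let `A` be a commutative (unital) Banach algebra, `T` a representation of `G` as algebra
automorphisms of `A`, `S` a submonoid of `G` and `Γ` a Banach module over `A`. The monoid
representation `𝒯` of `S` on `Γ` makes `Γ` an `S`-dynamical Banach module over `(A; T)` if each
`𝒯 g` is a `T g`-homomorphism and `𝒯` is strongly continuous. (For a discrete group `G`, the only
case used here, `S` is closed in `G` and `T` is strongly continuous, so neither is demanded.) -/
structure IsDynamicalBanachModule {𝕜 G A Γ : Type*} [RCLike 𝕜] [Group G] [TopologicalSpace G]
    [NormedCommRing A] [NormedAlgebra 𝕜 A] [CompleteSpace A]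
    [NormedAddCommGroup Γ] [NormedSpace 𝕜 Γ] [CompleteSpace Γ] [Module A Γ]
    [IsScalarTower 𝕜 A Γ] [IsBoundedSMul A Γ]
    (T : G →* (A →ₐ[𝕜] A)) (S : Submonoid G) (𝒯 : S →* (Γ →L[𝕜] Γ)) : Prop where
  map_smul : ∀ (g : S) (f : A) (s : Γ), 𝒯 g (f • s) = T g f • 𝒯 g s
  strongly_continuous : ∀ s : Γ, Continuous fun g : S => 𝒯 g s

end Dynamics

/-! ### Morphisms of measurable Banach bundles -/

section Morphism

open MeasurableBanachBundle

variable {Ω 𝕜 : Type*} [RCLike 𝕜] [MeasurableSpace Ω] {μ : Measure Ω}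
  {E : Ω → Type*} [∀ x, NormedAddCommGroup (E x)] [∀ x, NormedSpace 𝕜 (E x)]
  [∀ x, CompleteSpace (E x)]
  {F : Ω → Type*} [∀ x, NormedAddCommGroup (F x)] [∀ x, NormedSpace 𝕜 (F x)]
  [∀ x, CompleteSpace (F x)]
  {H : Ω → Type*} [∀ x, NormedAddCommGroup (H x)] [∀ x, NormedSpace 𝕜 (H x)]
  [∀ x, CompleteSpace (H x)]

/-- A premorphism of measurable Banach bundles over `φ`: a map of the total spaces which, up to
null sets, maps measurable sections to measurable sections along `φ`, maps `E x` to `F (φ x)` by a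
bounded linear operator, and is essentially bounded. -/
structure BundlePremorphism (𝓔 : MeasurableBanachBundle 𝕜 μ E) (𝓕 : MeasurableBanachBundle 𝕜 μ F)
    (φ : Ω → Ω) where
  /-- the map of total spaces -/
  toFun : (Σ x, E x) → (Σ x, F x)
  map_sections : ∀ s ∈ 𝓔.measurableSections, ∃ t ∈ 𝓕.measurableSections,
    ∀ᵐ x ∂μ, toFun ⟨x, s x⟩ = ⟨φ x, t (φ x)⟩
  fiberwise : ∀ᵐ x ∂μ, ∃ A : E x →L[𝕜] F (φ x), ∀ v : E x, toFun ⟨x, v⟩ = ⟨φ x, A v⟩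
  bounded : ∃ C : ℝ, ∀ᵐ x ∂μ, ∀ v : E x, ‖(toFun ⟨x, v⟩).2‖ ≤ C * ‖v‖

variable {𝓔 : MeasurableBanachBundle 𝕜 μ E} {𝓕 : MeasurableBanachBundle 𝕜 μ F}
  {𝓗 : MeasurableBanachBundle 𝕜 μ H} {φ ψ χ : Ω → Ω}

namespace BundlePremorphism

/-- Premorphisms are identified when they agree on almost every fiber. -/
instance instSetoid (𝓔 : MeasurableBanachBundle 𝕜 μ E) (𝓕 : MeasurableBanachBundle 𝕜 μ F)
    (φ : Ω → Ω) : Setoid (BundlePremorphism 𝓔 𝓕 φ) where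
  r Φ Ψ := ∀ᵐ x ∂μ, ∀ v : E x, Φ.toFun ⟨x, v⟩ = Ψ.toFun ⟨x, v⟩
  iseqv :=
    { refl := fun _ => .of_forall fun _ _ => rfl
      symm := fun h => h.mono fun _ hx v => (hx v).symm
      trans := fun h h' => by
        filter_upwards [h, h'] with x hx hx' v
        rw [hx, hx'] }

theorem equiv_def {Φ Ψ : BundlePremorphism 𝓔 𝓕 φ} :
    Φ ≈ Ψ ↔ ∀ᵐ x ∂μ, ∀ v : E x, Φ.toFun ⟨x, v⟩ = Ψ.toFun ⟨x, v⟩ := Iff.rfl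

/-- The identity, as a premorphism over any map which agrees with `id` almost everywhere. -/
protected def id (𝓔 : MeasurableBanachBundle 𝕜 μ E) (hφ : ∀ᵐ x ∂μ, φ x = x) :
    BundlePremorphism 𝓔 𝓔 φ where
  toFun v := v
  map_sections s hs := ⟨s, hs, by
    filter_upwards [hφ] with x hx
    rw [hx]⟩
  fiberwise := by
    filter_upwards [hφ] with x hx
    rw [hx]
    exact ⟨.id 𝕜 (E x), fun v => rfl⟩
  bounded := ⟨1, .of_forall fun x v => (one_mul _).ge⟩

/-- The composition `Ψ ∘ Φ`, as a premorphism over any map which agrees with `ψ ∘ φ` almost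
everywhere. -/
def comp (hφ : MeasurePreserving φ μ μ) (hχ : ∀ᵐ x ∂μ, χ x = ψ (φ x))
    (Ψ : BundlePremorphism 𝓕 𝓗 ψ) (Φ : BundlePremorphism 𝓔 𝓕 φ) : BundlePremorphism 𝓔 𝓗 χ where
  toFun v := Ψ.toFun (Φ.toFun v)
  map_sections s hs := by
    obtain ⟨t, ht, hst⟩ := Φ.map_sections s hs
    obtain ⟨u, hu, htu⟩ := Ψ.map_sections t ht
    refine ⟨u, hu, ?_⟩
    filter_upwards [hst, hφ.quasiMeasurePreserving.ae htu, hχ] with x h1 h2 h3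
    rw [h1, h2, h3]
  fiberwise := by
    filter_upwards [Φ.fiberwise, hφ.quasiMeasurePreserving.ae Ψ.fiberwise, hχ] with x hA hB h3
    obtain ⟨A, hA⟩ := hA
    obtain ⟨B, hB⟩ := hB
    rw [h3]
    exact ⟨B.comp A, fun v => by rw [hA, hB]; rfl⟩
  bounded := by
    obtain ⟨C, hC⟩ := Φ.bounded
    obtain ⟨D, hD⟩ := Ψ.bounded
    refine ⟨|D| * C, ?_⟩
    filter_upwards [hC, hφ.quasiMeasurePreserving.ae hD, Φ.fiberwise] with x h1 h2 h3 v
    obtain ⟨A, hA⟩ := h3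
    have h1' := h1 v
    rw [hA] at h1' ⊢
    calc ‖(Ψ.toFun ⟨φ x, A v⟩).2‖ ≤ D * ‖A v‖ := h2 _
      _ ≤ |D| * ‖A v‖ := by gcongr; exact le_abs_self D
      _ ≤ |D| * (C * ‖v‖) := by gcongr
      _ = _ := by ring

open Classical in
/-- The section `Φ ∘ s ∘ ψ`, where `ψ` is the inverse of `φ`; on the null set of points `x` at
which the value is not in the fiber over `x`, it is replaced by zero. -/
def pushSection (Φ : BundlePremorphism 𝓔 𝓕 φ) (ψ : Ω → Ω) (s : ∀ x, E x) (x : Ω) : F x :=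
  if h : (Φ.toFun ⟨ψ x, s (ψ x)⟩).1 = x then h ▸ (Φ.toFun ⟨ψ x, s (ψ x)⟩).2 else 0

theorem pushSection_eq (Φ : BundlePremorphism 𝓔 𝓕 φ) {s : ∀ x, E x} {x : Ω} {w : F x}
    (h : Φ.toFun ⟨ψ x, s (ψ x)⟩ = ⟨x, w⟩) : Φ.pushSection ψ s x = w := by
  have h1 : (Φ.toFun ⟨ψ x, s (ψ x)⟩).1 = x := by rw [h]
  rw [pushSection, dif_pos h1]
  generalize Φ.toFun ⟨ψ x, s (ψ x)⟩ = p at h h1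
  subst h
  rfl

/-- Off a null set, `Φ ∘ s ∘ ψ` is a section and agrees with `pushSection`. -/
theorem pushSection_spec (hψ : MeasurePreserving ψ μ μ) (hφψ : ∀ᵐ x ∂μ, φ (ψ x) = x)
    (Φ : BundlePremorphism 𝓔 𝓕 φ) :
    ∀ᵐ x ∂μ, ∀ s : ∀ x, E x, Φ.toFun ⟨ψ x, s (ψ x)⟩ = ⟨x, Φ.pushSection ψ s x⟩ := by
  filter_upwards [hψ.quasiMeasurePreserving.ae Φ.fiberwise, hφψ] with x hA hx s
  obtain ⟨A, hA⟩ := hA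
  have h : ∃ w : F x, Φ.toFun ⟨ψ x, s (ψ x)⟩ = ⟨x, w⟩ := by
    rw [hA]
    generalize A (s (ψ x)) = w
    revert w
    rw [hx]
    exact fun w => ⟨w, rfl⟩
  obtain ⟨w, hw⟩ := h
  rw [Φ.pushSection_eq hw, hw]

theorem pushSection_mem (hψ : MeasurePreserving ψ μ μ) (hφψ : ∀ᵐ x ∂μ, φ (ψ x) = x)
    (Φ : BundlePremorphism 𝓔 𝓕 φ) {s : ∀ x, E x} (hs : s ∈ 𝓔.measurableSections) :
    Φ.pushSection ψ s ∈ 𝓕.measurableSections := by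
  obtain ⟨t, ht, hst⟩ := Φ.map_sections s hs
  refine 𝓕.mem_congr ht ?_
  filter_upwards [hψ.quasiMeasurePreserving.ae hst, hφψ] with x h1 h2
  exact Φ.pushSection_eq (by rw [h1, h2])

theorem norm_pushSection_le (hψ : MeasurePreserving ψ μ μ) (hφψ : ∀ᵐ x ∂μ, φ (ψ x) = x)
    (Φ : BundlePremorphism 𝓔 𝓕 φ) : ∃ C : ℝ, 0 ≤ C ∧ ∀ᵐ x ∂μ, ∀ s : ∀ x, E x,
      ‖Φ.pushSection ψ s x‖ ≤ C * ‖s (ψ x)‖ := by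
  obtain ⟨C, hC⟩ := Φ.bounded
  refine ⟨|C|, abs_nonneg C, ?_⟩
  filter_upwards [hψ.quasiMeasurePreserving.ae hC, Φ.pushSection_spec hψ hφψ] with x h1 h2 s
  have h := h1 (s (ψ x))
  rw [h2 s] at h
  exact h.trans (mul_le_mul_of_nonneg_right (le_abs_self C) (norm_nonneg _))

theorem pushSection_add (hψ : MeasurePreserving ψ μ μ) (hφψ : ∀ᵐ x ∂μ, φ (ψ x) = x)
    (Φ : BundlePremorphism 𝓔 𝓕 φ) (s t : ∀ x, E x) :
    ∀ᵐ x ∂μ, Φ.pushSection ψ (s + t) x = Φ.pushSection ψ s x + Φ.pushSection ψ t x := by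
  filter_upwards [hψ.quasiMeasurePreserving.ae Φ.fiberwise, hφψ] with x hA hx
  obtain ⟨A, hA⟩ := hA
  have key : ∃ B : E (ψ x) →L[𝕜] F x, ∀ v, Φ.toFun ⟨ψ x, v⟩ = ⟨x, B v⟩ := by
    revert A
    rw [hx]
    exact fun A hA => ⟨A, hA⟩
  obtain ⟨B, hB⟩ := key
  rw [Φ.pushSection_eq (hB _), Φ.pushSection_eq (hB _), Φ.pushSection_eq (hB _), Pi.add_apply,
    map_add]

theorem pushSection_smul (hψ : MeasurePreserving ψ μ μ) (hφψ : ∀ᵐ x ∂μ, φ (ψ x) = x)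
    (Φ : BundlePremorphism 𝓔 𝓕 φ) (c : 𝕜) (s : ∀ x, E x) :
    ∀ᵐ x ∂μ, Φ.pushSection ψ (c • s) x = c • Φ.pushSection ψ s x := by
  filter_upwards [hψ.quasiMeasurePreserving.ae Φ.fiberwise, hφψ] with x hA hx
  obtain ⟨A, hA⟩ := hA
  have key : ∃ B : E (ψ x) →L[𝕜] F x, ∀ v, Φ.toFun ⟨ψ x, v⟩ = ⟨x, B v⟩ := by
    revert A
    rw [hx]
    exact fun A hA => ⟨A, hA⟩
  obtain ⟨B, hB⟩ := key
  rw [Φ.pushSection_eq (hB _), Φ.pushSection_eq (hB _), Pi.smul_apply, map_smul]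

/-- `Φ ∘ s ∘ ψ` for an integrable section `s`. -/
def push (hψ : MeasurePreserving ψ μ μ) (hφψ : ∀ᵐ x ∂μ, φ (ψ x) = x)
    (Φ : BundlePremorphism 𝓔 𝓕 φ) (s : 𝓔.IntegrableSection) : 𝓕.IntegrableSection :=
  .of (Φ.pushSection ψ s) (Φ.pushSection_mem hψ hφψ s.mem) <| by
    obtain ⟨C, -, hC⟩ := Φ.norm_pushSection_le hψ hφψ
    refine ((hψ.integrable_comp_of_integrable s.integrable).const_mul C).mono
      (𝓕.measurable_norm _ (Φ.pushSection_mem hψ hφψ s.mem)).aestronglyMeasurable ?_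
    filter_upwards [hC] with x hx
    rw [norm_norm]
    exact (hx s).trans (le_abs_self _)

/-- The weighted Koopman operator `𝒯_Φ : Γ¹(E) → Γ¹(F)`, `s ↦ Φ ∘ s ∘ ψ`, of a premorphism `Φ` over
`φ`, where `ψ` is the inverse of `φ`. -/
def weightedKoopman (hψ : MeasurePreserving ψ μ μ) (hφψ : ∀ᵐ x ∂μ, φ (ψ x) = x)
    (Φ : BundlePremorphism 𝓔 𝓕 φ) : 𝓔.GammaOne →L[𝕜] 𝓕.GammaOne :=
  LinearMap.mkContinuousOfExistsBound
    { toFun := SeparationQuotient.lift (fun s => GammaOne.mk (Φ.push hψ hφψ s)) fun s t h => by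
        have h' := GammaOne.mk_eq_mk.1 (SeparationQuotient.mk_eq_mk.2 h)
        refine GammaOne.mk_eq_mk.2 ?_
        filter_upwards [hψ.quasiMeasurePreserving.ae h', Φ.pushSection_spec hψ hφψ] with x h1 h2
        refine Φ.pushSection_eq ?_
        rw [h1]
        exact h2 t
      map_add' := fun s t => by
        obtain ⟨s, rfl⟩ := SeparationQuotient.surjective_mk s
        obtain ⟨t, rfl⟩ := SeparationQuotient.surjective_mk t
        exact GammaOne.mk_eq_mk.2 (Φ.pushSection_add hψ hφψ s t)
      map_smul' := fun c s => by
        obtain ⟨s, rfl⟩ := SeparationQuotient.surjective_mk s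
        exact GammaOne.mk_eq_mk.2 (Φ.pushSection_smul hψ hφψ c s) } <| by
    obtain ⟨C, hC0, hC⟩ := Φ.norm_pushSection_le hψ hφψ
    refine ⟨C, fun s => ?_⟩
    obtain ⟨s, rfl⟩ := SeparationQuotient.surjective_mk s
    change ‖GammaOne.mk (Φ.push hψ hφψ s)‖ ≤ C * ‖GammaOne.mk s‖
    rw [GammaOne.norm_mk, GammaOne.norm_mk]
    have hi := hψ.integrable_comp_of_integrable s.integrable
    have h2 : ∫ x, ‖s (ψ x)‖ ∂μ = ∫ x, ‖s x‖ ∂μ := by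
      have h := integral_map (μ := μ) hψ.aemeasurable (f := fun x => ‖s x‖)
        (𝓔.measurable_norm _ s.mem).aestronglyMeasurable
      rw [hψ.map_eq] at h
      exact h.symm
    rw [← h2, ← integral_const_mul]
    refine integral_mono_ae (Φ.push hψ hφψ s).integrable (hi.const_mul C) ?_
    filter_upwards [hC] with x hx
    exact hx s

theorem weightedKoopman_mk (hψ : MeasurePreserving ψ μ μ) (hφψ : ∀ᵐ x ∂μ, φ (ψ x) = x)
    (Φ : BundlePremorphism 𝓔 𝓕 φ) (s : 𝓔.IntegrableSection) :
    Φ.weightedKoopman hψ hφψ (GammaOne.mk s) = GammaOne.mk (Φ.push hψ hφψ s) := rfl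

theorem push_apply (hψ : MeasurePreserving ψ μ μ) (hφψ : ∀ᵐ x ∂μ, φ (ψ x) = x)
    (Φ : BundlePremorphism 𝓔 𝓕 φ) (s : 𝓔.IntegrableSection) (x : Ω) :
    Φ.push hψ hφψ s x = Φ.pushSection ψ s x := rfl

end BundlePremorphism

/-- A morphism of measurable Banach bundles over `φ`: a class of premorphisms. -/
def BundleMorphism (𝓔 : MeasurableBanachBundle 𝕜 μ E) (𝓕 : MeasurableBanachBundle 𝕜 μ F)
    (φ : Ω → Ω) : Type _ :=
  Quotient (BundlePremorphism.instSetoid 𝓔 𝓕 φ)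

namespace BundleMorphism

/-- The identity morphism, over any map which agrees with `id` almost everywhere. -/
protected def id (𝓔 : MeasurableBanachBundle 𝕜 μ E) (hφ : ∀ᵐ x ∂μ, φ x = x) :
    BundleMorphism 𝓔 𝓔 φ :=
  Quotient.mk _ (BundlePremorphism.id 𝓔 hφ)

/-- The composition of morphisms, over any map which agrees with `ψ ∘ φ` almost everywhere. -/
def comp (hφ : MeasurePreserving φ μ μ) (hχ : ∀ᵐ x ∂μ, χ x = ψ (φ x)) :
    BundleMorphism 𝓕 𝓗 ψ → BundleMorphism 𝓔 𝓕 φ → BundleMorphism 𝓔 𝓗 χ :=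
  Quotient.map₂ (BundlePremorphism.comp hφ hχ) fun Ψ Ψ' hΨ Φ Φ' hΦ => by
    rw [BundlePremorphism.equiv_def] at *
    filter_upwards [hφ.quasiMeasurePreserving.ae hΨ, hΦ, Φ'.fiberwise] with x h1 h2 h3 v
    obtain ⟨A, hA⟩ := h3
    change Ψ.toFun (Φ.toFun ⟨x, v⟩) = Ψ'.toFun (Φ'.toFun ⟨x, v⟩)
    rw [h2, hA, h1]

/-- The weighted Koopman operator `𝒯_Φ s = Φ ∘ s ∘ ψ` of a morphism `Φ` over `φ`, where `ψ` is the
inverse of `φ`. -/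
def weightedKoopman (hψ : MeasurePreserving ψ μ μ) (hφψ : ∀ᵐ x ∂μ, φ (ψ x) = x) :
    BundleMorphism 𝓔 𝓕 φ → (𝓔.GammaOne →L[𝕜] 𝓕.GammaOne) :=
  Quotient.lift (BundlePremorphism.weightedKoopman hψ hφψ) fun Φ Φ' h => by
    rw [BundlePremorphism.equiv_def] at h
    refine ContinuousLinearMap.ext fun s => ?_
    obtain ⟨s, rfl⟩ := SeparationQuotient.surjective_mk s
    refine GammaOne.mk_eq_mk.2 ?_
    filter_upwards [hψ.quasiMeasurePreserving.ae h, Φ'.pushSection_spec hψ hφψ] with x h1 h2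
    exact Φ.pushSection_eq ((h1 _).trans (h2 _))

end BundleMorphism

/-- An `S`-dynamical Banach bundle `(E; Φ)` over the measure-preserving system `φ`, with given
underlying bundle `E`. -/
@[ext]
structure DynamicalBanachBundle {G : Type*} [Group G] (𝓔 : MeasurableBanachBundle 𝕜 μ E)
    (φ : MeasurePreservingSystem G μ) (S : Submonoid G) where
  /-- the morphism `Φ_g` over `φ_g` -/
  map : ∀ g : S, BundleMorphism 𝓔 𝓔 (φ g)
  map_one : map 1 = BundleMorphism.id 𝓔 φ.map_one
  map_mul : ∀ g h : S, map (g * h) =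
    BundleMorphism.comp (φ.measurePreserving h) (φ.map_mul g h) (map g) (map h)

namespace DynamicalBanachBundle

variable {G : Type*} [Group G] {φ : MeasurePreservingSystem G μ} {S : Submonoid G}

/-- The weighted Koopman representation of `(E; Φ)` on `Γ¹(E)`: `𝒯_Φ(g) s = Φ_g ∘ s ∘ φ_g⁻¹`. -/
def weightedKoopman (Φ : DynamicalBanachBundle 𝓔 φ S) : S →* (𝓔.GammaOne →L[𝕜] 𝓔.GammaOne) where
  toFun g := (Φ.map g).weightedKoopman (φ.measurePreserving (g : G)⁻¹) (φ.apply_inv g)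
  map_one' := by
    rw [Φ.map_one]
    refine ContinuousLinearMap.ext fun s => ?_
    obtain ⟨s, rfl⟩ := SeparationQuotient.surjective_mk s
    refine GammaOne.mk_eq_mk.2 ?_
    filter_upwards [φ.map_one] with x hx
    refine BundlePremorphism.pushSection_eq _ ?_
    change (⟨φ (1 : G)⁻¹ x, s (φ (1 : G)⁻¹ x)⟩ : Σ x, E x) = _
    rw [inv_one, hx]
  map_mul' g h := by
    rw [Φ.map_mul]
    generalize Φ.map g = Φg
    generalize Φ.map h = Φh
    induction Φg using Quotient.inductionOn with | _ Φg
    induction Φh using Quotient.inductionOn with | _ Φh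
    refine ContinuousLinearMap.ext fun s => ?_
    obtain ⟨s, rfl⟩ := SeparationQuotient.surjective_mk s
    refine GammaOne.mk_eq_mk.2 ?_
    filter_upwards [φ.map_mul (h : G)⁻¹ (g : G)⁻¹,
      Φg.pushSection_spec (φ.measurePreserving (g : G)⁻¹) (φ.apply_inv g),
      (φ.measurePreserving (g : G)⁻¹).quasiMeasurePreserving.ae
        (Φh.pushSection_spec (φ.measurePreserving (h : G)⁻¹) (φ.apply_inv h))] with x h1 h2 h3
    refine BundlePremorphism.pushSection_eq _ ?_
    rw [← mul_inv_rev] at h1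
    change Φg.toFun (Φh.toFun ⟨φ ((g : G) * (h : G))⁻¹ x, s (φ ((g : G) * (h : G))⁻¹ x)⟩) = _
    rw [h1, h3, h2]
    rfl

end DynamicalBanachBundle

end Morphism

end

/-! The point is that an `L^∞`-semilinear operator `T` over `φ` is local. Write `ψ` for the almost
everywhere inverse of `φ`. Multiplying a section by indicator functions localizes the inequality `‖T
s‖ ≤ ‖T‖ ‖s‖` between integrals to arbitrary sets of finite measure, which yields the pointwise
bound `|T s| ≤ ‖T‖ |s ∘ ψ|` (`ae_norm_apply_le`). So `(T s)(φ x)` ought to depend on `s x` alone,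
but the exceptional null set still depends on `s`.

Separability removes this dependence. Take integrable sections `u n` whose values span a dense
subspace of almost every fiber. A single null set serves for the bound on `s` minus all linear
combinations of the `u n` (`ae_norm_sub_linearCombination_le`). Off a null set, `u n x ↦ (T (u n))(φ
x)` therefore extends to a bounded operator `A x` on the fiber, and approximating `s x` by linear
combinations gives `A x (s x) = (T s)(φ x)`. These operators form a morphism with Koopman operator
`T` (`exists_weightedKoopman_eq`).

Conversely, a morphism is determined on almost every fiber by its values on the `u n`, hence by its
Koopman operator (`weightedKoopman_injective`). This gives uniqueness, and also the identities for
`Φ_1` and `Φ_{gh}`: the passage to Koopman operators respects identities and compositions, so the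
relations between the operators `𝒯 g` are reflected in the morphisms. -/

/-! ### Integrable generating sections -/

/-- A measurable section can be made integrable by rescaling it with a strictly positive
measurable function. -/
theorem MeasurableBanachBundle.exists_pos_smul_integrable {Ω 𝕜 : Type*} [RCLike 𝕜]
    [MeasurableSpace Ω] {μ : Measure Ω} [SigmaFinite μ] {E : Ω → Type*}
    [∀ x, NormedAddCommGroup (E x)] [∀ x, NormedSpace 𝕜 (E x)] [∀ x, CompleteSpace (E x)]
    (𝓔 : MeasurableBanachBundle 𝕜 μ E) {s : ∀ x, E x} (hs : s ∈ 𝓔.measurableSections) :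
    ∃ f : Ω → ℝ, Measurable f ∧ (∀ x, 0 < f x) ∧
      ∃ s' : 𝓔.IntegrableSection, ∀ x, s' x = (f x : 𝕜) • s x := by
  -- The scaling factor is `w / (1 + |s|)` with `w` positive and integrable, so that the rescaled
  -- section has norm at most `w`; the summand `1` keeps the denominator positive where `s`
  -- vanishes.
  obtain ⟨w, hw0, hwm, hwi⟩ := exists_pos_lintegral_lt_of_sigmaFinite μ one_ne_zero
  have hsm := 𝓔.measurable_norm s hs
  have hfm : Measurable fun x => (w x : ℝ) / (1 + ‖s x‖) :=
    hwm.coe_nnreal_real.div (hsm.const_add 1)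
  have hmem : (fun x => ((((w x : ℝ) / (1 + ‖s x‖) : ℝ)) : 𝕜) • s x) ∈ 𝓔.measurableSections :=
    𝓔.smul_mem _ (RCLike.measurable_ofReal.comp hfm) s hs
  have hw : Integrable (fun x => (w x : ℝ)) μ := by
    refine ⟨hwm.coe_nnreal_real.aestronglyMeasurable, ?_⟩
    simpa [HasFiniteIntegral] using hwi.trans ENNReal.one_lt_top
  have hpos : ∀ x, 0 < (w x : ℝ) / (1 + ‖s x‖) := fun x =>
    div_pos (NNReal.coe_pos.2 (hw0 x)) (by positivity)
  refine ⟨_, hfm, hpos, .of _ hmem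
    (hw.mono (𝓔.measurable_norm _ hmem).aestronglyMeasurable (.of_forall fun x => ?_)),
    fun x => rfl⟩
  rw [norm_norm, norm_smul, RCLike.norm_ofReal, abs_of_pos (hpos x), div_mul_eq_mul_div,
    div_le_iff₀ (by positivity), NNReal.norm_eq]
  exact mul_le_mul_of_nonneg_left (by linarith) (w x).2

namespace MeasurableBanachBundle

variable {Ω 𝕜 : Type*} [RCLike 𝕜] [MeasurableSpace Ω] {μ : Measure Ω}
  {E : Ω → Type*} [∀ x, NormedAddCommGroup (E x)] [∀ x, NormedSpace 𝕜 (E x)]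
  [∀ x, CompleteSpace (E x)]
  {F : Ω → Type*} [∀ x, NormedAddCommGroup (F x)] [∀ x, NormedSpace 𝕜 (F x)]
  [∀ x, CompleteSpace (F x)]
  {𝓔 : MeasurableBanachBundle 𝕜 μ E} {𝓕 : MeasurableBanachBundle 𝕜 μ F} {φ ψ : Ω → Ω}

/-- In a separable bundle, the dense sequence of sections can be chosen integrable. -/
theorem IsSeparable.exists_integrable [SigmaFinite μ] (h : 𝓔.IsSeparable) :
    ∃ u : ℕ → 𝓔.IntegrableSection,
      ∀ᵐ x ∂μ, DenseRange (Finsupp.linearCombination 𝕜 fun n => u n x) := by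
  obtain ⟨u, hu, hd⟩ := h
  choose f hfm hf0 v hv using fun n => 𝓔.exists_pos_smul_integrable (hu n)
  refine ⟨v, ?_⟩
  filter_upwards [hd] with x hx
  -- Rescaling each generator by a nonzero scalar does not shrink the span.
  have hle : Submodule.span 𝕜 (Set.range fun n => u n x) ≤
      LinearMap.range (Finsupp.linearCombination 𝕜 fun n => v n x) := by
    rw [Finsupp.range_linearCombination, Submodule.span_le]
    rintro _ ⟨n, rfl⟩
    have h0 : (f n x : 𝕜) ≠ 0 := by exact_mod_cast (hf0 n x).ne'
    have : u n x = (f n x : 𝕜)⁻¹ • v n x := by rw [hv, inv_smul_smul₀ h0]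
    change u n x ∈ _
    rw [this]
    exact Submodule.smul_mem _ _ (Submodule.subset_span ⟨n, rfl⟩)
  exact hx.mono hle

namespace IntegrableSection

theorem finset_sum_smul_apply {ι : Type*} (I : Finset ι) (c : ι → 𝕜)
    (u : ι → 𝓔.IntegrableSection) (x : Ω) :
    (∑ i ∈ I, c i • u i) x = ∑ i ∈ I, c i • u i x := by
  classical
  induction I using Finset.induction_on with
  | empty => rfl
  | insert i I hi ih => rw [Finset.sum_insert hi, Finset.sum_insert hi, add_apply, ih, smul_apply]

end IntegrableSection

/-! ### Locality: pointwise norm bounds for semilinear operators -/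

namespace GammaOne

theorem mk_sub_finset_sum_smul {ι : Type*} (I : Finset ι) (c : ι → 𝕜) (s : 𝓔.IntegrableSection)
    (u : ι → 𝓔.IntegrableSection) :
    mk (s - ∑ i ∈ I, c i • u i) = mk s - ∑ i ∈ I, c i • mk (u i) := by
  simp only [mk, SeparationQuotient.mk_sub, ← SeparationQuotient.mk_smul]
  congr 1
  exact map_sum (SeparationQuotient.mkCLM 𝕜 _) _ _

/-- A continuous linear map `T : Γ¹(E) → Γ¹(F)` with `T (f s) = (f ∘ ψ) T s` satisfies
`|T s| ≤ ‖T‖ |s ∘ ψ|` almost everywhere. -/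
theorem ae_norm_apply_le (hφ : MeasurePreserving φ μ μ) (hψ : MeasurePreserving ψ μ μ)
    (hφψ : ∀ᵐ x ∂μ, φ (ψ x) = x) {T : 𝓔.GammaOne →L[𝕜] 𝓕.GammaOne}
    (hT : ∀ (f : Lp 𝕜 ∞ μ) s, T (f • s) = Lp.compMeasurePreserving ψ hψ f • T s)
    {s : 𝓔.IntegrableSection} {t : 𝓕.IntegrableSection} (hst : T (mk s) = mk t) :
    ∀ᵐ x ∂μ, ‖t x‖ ≤ ‖T‖ * ‖s (ψ x)‖ := by
  -- It suffices to compare integrals over all `A` of finite measure. The test function is the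
  -- indicator of `φ ⁻¹' A`, because its composition with `ψ` is the indicator of `A` almost
  -- everywhere; both integrals then become norms in `Γ¹`.
  refine ae_le_of_forall_setIntegral_le t.integrable
    ((hψ.integrable_comp_of_integrable s.integrable).const_mul _) fun A hA hμA => ?_
  have hB : MeasurableSet (φ ⁻¹' A) := hφ.measurable hA
  have hμB : μ (φ ⁻¹' A) ≠ ∞ := by
    rw [hφ.measure_preimage hA.nullMeasurableSet]
    exact hμA.ne
  set f : Lp 𝕜 ∞ μ := indicatorConstLp ∞ hB hμB 1
  have hf : ∀ᵐ x ∂μ, f x = (φ ⁻¹' A).indicator (fun _ => 1) x := indicatorConstLp_coeFn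
  have h1 : ‖T (f • mk s)‖ = ∫ x in A, ‖t x‖ ∂μ := by
    rw [hT, hst, smul_mk, norm_mk, ← integral_indicator hA]
    refine integral_congr_ae ?_
    filter_upwards [Lp.coeFn_compMeasurePreserving f hψ, hψ.quasiMeasurePreserving.ae hf, hφψ]
      with x h1 h2 h3
    rw [smulSection_apply, h1, Function.comp_apply, h2]
    by_cases hx : x ∈ A <;> simp [h3, hx]
  have h2 : ‖f • mk s‖ = ∫ x in A, ‖s (ψ x)‖ ∂μ := by
    have h := integral_map (μ := μ) hψ.aemeasurable (f := fun x => ‖smulSection f s x‖)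
      (𝓔.measurable_norm _ (smulSection f s).mem).aestronglyMeasurable
    rw [hψ.map_eq] at h
    rw [smul_mk, norm_mk, h, ← integral_indicator hA]
    refine integral_congr_ae ?_
    filter_upwards [hψ.quasiMeasurePreserving.ae hf, hφψ] with x h2 h3
    rw [smulSection_apply, h2]
    by_cases hx : x ∈ A <;> simp [h3, hx]
  rw [integral_const_mul, ← h1, ← h2]
  exact T.le_opNorm _

/-- The estimate `|T s| ≤ ‖T‖ |s ∘ ψ|`, simultaneously for all differences of `s` and a linear
combination of countably many sections. -/
theorem ae_norm_sub_linearCombination_le (hφ : MeasurePreserving φ μ μ)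
    (hψ : MeasurePreserving ψ μ μ) (hφψ : ∀ᵐ x ∂μ, φ (ψ x) = x) (hψφ : ∀ᵐ x ∂μ, ψ (φ x) = x)
    {T : 𝓔.GammaOne →L[𝕜] 𝓕.GammaOne}
    (hT : ∀ (f : Lp 𝕜 ∞ μ) s, T (f • s) = Lp.compMeasurePreserving ψ hψ f • T s)
    {s : 𝓔.IntegrableSection} {t : 𝓕.IntegrableSection} (hst : T (mk s) = mk t)
    {u : ℕ → 𝓔.IntegrableSection} {v : ℕ → 𝓕.IntegrableSection}
    (huv : ∀ n, T (mk (u n)) = mk (v n)) :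
    ∀ᵐ x ∂μ, ∀ c : ℕ →₀ 𝕜, ‖t (φ x) - Finsupp.linearCombination 𝕜 (fun n => v n (φ x)) c‖ ≤
      ‖T‖ * ‖s x - Finsupp.linearCombination 𝕜 (fun n => u n x) c‖ := by
  -- There are uncountably many `c`, so the null sets cannot be united directly. The bound is first
  -- obtained for coefficients in a countable dense set `D` and each of the countably many finite
  -- index sets.
  obtain ⟨D, hDc, hD⟩ := TopologicalSpace.exists_countable_dense (ℕ → 𝕜)
  have key : ∀ᵐ x ∂μ, ∀ I : Finset ℕ, ∀ c ∈ D,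
      ‖t (φ x) - ∑ i ∈ I, c i • v i (φ x)‖ ≤ ‖T‖ * ‖s x - ∑ i ∈ I, c i • u i x‖ := by
    rw [ae_all_iff]
    refine fun I => (ae_ball_iff hDc).2 fun c _ => ?_
    have hsum : T (mk (s - ∑ i ∈ I, c i • u i)) = mk (t - ∑ i ∈ I, c i • v i) := by
      rw [mk_sub_finset_sum_smul, mk_sub_finset_sum_smul, map_sub, map_sum, hst]
      simp only [map_smul, huv]
    filter_upwards [hφ.quasiMeasurePreserving.ae (ae_norm_apply_le hφ hψ hφψ hT hsum), hψφ]
      with x h1 h2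
    rw [h2] at h1
    simpa only [IntegrableSection.sub_apply, IntegrableSection.finset_sum_smul_apply] using h1
  filter_upwards [key] with x hx c
  -- With the support of `c` fixed, both sides depend continuously on finitely many coordinates, so
  -- the bound passes from `D` to its closure, which contains `c`.
  have hcl : IsClosed {d : ℕ → 𝕜 | ‖t (φ x) - ∑ i ∈ c.support, d i • v i (φ x)‖ ≤
      ‖T‖ * ‖s x - ∑ i ∈ c.support, d i • u i x‖} :=
    isClosed_le (by fun_prop) (by fun_prop)
  exact hcl.closure_subset_iff.2 (hx c.support) (hD c)

end GammaOne

end MeasurableBanachBundle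

/-! ### Morphisms and their weighted Koopman operators -/

namespace BundleMorphism

open MeasurableBanachBundle

variable {Ω 𝕜 : Type*} [RCLike 𝕜] [MeasurableSpace Ω] {μ : Measure Ω}
  {E : Ω → Type*} [∀ x, NormedAddCommGroup (E x)] [∀ x, NormedSpace 𝕜 (E x)]
  [∀ x, CompleteSpace (E x)]
  {F : Ω → Type*} [∀ x, NormedAddCommGroup (F x)] [∀ x, NormedSpace 𝕜 (F x)]
  [∀ x, CompleteSpace (F x)]
  {H : Ω → Type*} [∀ x, NormedAddCommGroup (H x)] [∀ x, NormedSpace 𝕜 (H x)]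
  [∀ x, CompleteSpace (H x)]
  {𝓔 : MeasurableBanachBundle 𝕜 μ E} {𝓕 : MeasurableBanachBundle 𝕜 μ F}
  {𝓗 : MeasurableBanachBundle 𝕜 μ H} {φ ψ φ' ψ' χ ω : Ω → Ω}

/-- A morphism out of a separable bundle is determined by its weighted Koopman operator. -/
theorem weightedKoopman_injective [SigmaFinite μ] (h𝓔 : 𝓔.IsSeparable)
    (hφ : MeasurePreserving φ μ μ) (hψ : MeasurePreserving ψ μ μ)
    (hφψ : ∀ᵐ x ∂μ, φ (ψ x) = x) (hψφ : ∀ᵐ x ∂μ, ψ (φ x) = x) :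
    Function.Injective (weightedKoopman (𝓔 := 𝓔) (𝓕 := 𝓕) hψ hφψ) := by
  intro Φ Φ' h
  induction Φ using Quotient.inductionOn with | _ Φ
  induction Φ' using Quotient.inductionOn with | _ Φ'
  obtain ⟨u, hu⟩ := h𝓔.exists_integrable
  have h1 : ∀ n, ∀ᵐ x ∂μ, Φ.pushSection ψ (u n) x = Φ'.pushSection ψ (u n) x := fun n =>
    GammaOne.mk_eq_mk.1 (congrArg (fun T => T (GammaOne.mk (u n))) h)
  refine Quotient.sound (BundlePremorphism.equiv_def.2 ?_)
  -- Equality of the pushed sections is known at a target point; pulling back along `φ` reads it at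
  -- `φ x`, where `ψ (φ x) = x` returns to the fiber over `x`.
  filter_upwards [hu, Φ.fiberwise, Φ'.fiberwise, hψφ,
    hφ.quasiMeasurePreserving.ae (ae_all_iff.2 h1),
    hφ.quasiMeasurePreserving.ae (Φ.pushSection_spec hψ hφψ),
    hφ.quasiMeasurePreserving.ae (Φ'.pushSection_spec hψ hφψ)] with x hd ⟨A, hA⟩ ⟨B, hB⟩ h3 h4 h5 h6 v
  rw [h3] at h5 h6
  have hAB : ∀ n, A (u n x) = B (u n x) := fun n => by
    have h := (h5 (u n)).trans ((congrArg (Sigma.mk (φ x)) (h4 n)).trans (h6 (u n)).symm)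
    rw [hA, hB] at h
    exact eq_of_heq (Sigma.mk.inj h).2
  have : A = B := ContinuousLinearMap.coeFn_injective <| hd.equalizer A.continuous B.continuous <| by
    ext c
    simp only [Function.comp_apply, Finsupp.linearCombination_apply, Finsupp.sum, map_sum, map_smul,
      hAB]
  rw [hA, hB, this]

theorem weightedKoopman_id (hψ : MeasurePreserving ψ μ μ) (hφ : ∀ᵐ x ∂μ, φ x = x)
    (hφψ : ∀ᵐ x ∂μ, φ (ψ x) = x) :
    (BundleMorphism.id 𝓔 hφ).weightedKoopman hψ hφψ = 1 := by
  refine ContinuousLinearMap.ext fun s => ?_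
  obtain ⟨s, rfl⟩ := SeparationQuotient.surjective_mk s
  refine GammaOne.mk_eq_mk.2 ?_
  filter_upwards [hφψ, hψ.quasiMeasurePreserving.ae hφ] with x h1 h2
  refine BundlePremorphism.pushSection_eq _ ?_
  change (⟨ψ x, s (ψ x)⟩ : Σ x, E x) = _
  rw [← h2, h1]

/-- Together with `weightedKoopman_id` and injectivity, this lets the relations in `S` be checked on
operators. The map `ω` is only almost everywhere equal to `ψ ∘ ψ'`, since `φ` is a homomorphism only
modulo null sets. -/
theorem weightedKoopman_comp (hφ : MeasurePreserving φ μ μ) (hψ : MeasurePreserving ψ μ μ)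
    (hψ' : MeasurePreserving ψ' μ μ) (hω : MeasurePreserving ω μ μ)
    (hφψ : ∀ᵐ x ∂μ, φ (ψ x) = x) (hφψ' : ∀ᵐ x ∂μ, φ' (ψ' x) = x) (hχω : ∀ᵐ x ∂μ, χ (ω x) = x)
    (hχ : ∀ᵐ x ∂μ, χ x = φ' (φ x)) (hω' : ∀ᵐ x ∂μ, ω x = ψ (ψ' x))
    (Ψ : BundleMorphism 𝓕 𝓗 φ') (Φ : BundleMorphism 𝓔 𝓕 φ) :
    (comp hφ hχ Ψ Φ).weightedKoopman hω hχω =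
      (Ψ.weightedKoopman hψ' hφψ').comp (Φ.weightedKoopman hψ hφψ) := by
  induction Φ using Quotient.inductionOn with | _ Φ
  induction Ψ using Quotient.inductionOn with | _ Ψ
  refine ContinuousLinearMap.ext fun s => ?_
  obtain ⟨s, rfl⟩ := SeparationQuotient.surjective_mk s
  refine GammaOne.mk_eq_mk.2 ?_
  filter_upwards [hω', Ψ.pushSection_spec hψ' hφψ',
    hψ'.quasiMeasurePreserving.ae (Φ.pushSection_spec hψ hφψ)] with x h1 h2 h3
  refine BundlePremorphism.pushSection_eq _ ?_
  change Ψ.toFun (Φ.toFun ⟨ω x, s (ω x)⟩) = _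
  rw [h1, h3, h2]
  rfl

/-- Every bounded `L^∞`-semilinear operator `Γ¹(E) → Γ¹(F)` is the weighted Koopman operator of a
morphism, provided that `E` is separable. -/
theorem exists_weightedKoopman_eq [SigmaFinite μ] (h𝓔 : 𝓔.IsSeparable)
    (hφ : MeasurePreserving φ μ μ) (hψ : MeasurePreserving ψ μ μ)
    (hφψ : ∀ᵐ x ∂μ, φ (ψ x) = x) (hψφ : ∀ᵐ x ∂μ, ψ (φ x) = x) (T : 𝓔.GammaOne →L[𝕜] 𝓕.GammaOne)
    (hT : ∀ (f : Lp 𝕜 ∞ μ) s, T (f • s) = Lp.compMeasurePreserving ψ hψ f • T s) :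
    ∃ Φ : BundleMorphism 𝓔 𝓕 φ, Φ.weightedKoopman hψ hφψ = T := by
  obtain ⟨u, hu⟩ := h𝓔.exists_integrable
  -- `r s` is an arbitrary representative of `T s`; no linearity in `s` is required of this choice.
  choose r hr using fun s => SeparationQuotient.surjective_mk (T (GammaOne.mk s))
  let L (x : Ω) : (ℕ →₀ 𝕜) →ₗ[𝕜] E x := Finsupp.linearCombination 𝕜 fun n => u n x
  let M (x : Ω) : (ℕ →₀ 𝕜) →ₗ[𝕜] F (φ x) := Finsupp.linearCombination 𝕜 fun n => r (u n) (φ x)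
  -- The extension of `L x c ↦ M x c` from the dense range of `L x`. This is meaningful where `hML`
  -- and `hu` hold, that is, almost everywhere; elsewhere the value of `A x` plays no role.
  let A (x : Ω) : E x →L[𝕜] F (φ x) := (M x).extendOfNorm (L x)
  have hest (s : 𝓔.IntegrableSection) : ∀ᵐ x ∂μ, ∀ c,
      ‖r s (φ x) - M x c‖ ≤ ‖T‖ * ‖s x - L x c‖ :=
    GammaOne.ae_norm_sub_linearCombination_le hφ hψ hφψ hψφ hT (hr s).symm fun n => (hr (u n)).symm
  -- The case `s = 0` of the estimate: it makes `L x c ↦ M x c` well defined and bounded by `‖T‖`.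
  have hML : ∀ᵐ x ∂μ, ∀ c, ‖M x c‖ ≤ ‖T‖ * ‖L x c‖ := by
    have h0 : T (GammaOne.mk 0) = GammaOne.mk 0 := map_zero T
    filter_upwards [GammaOne.ae_norm_sub_linearCombination_le hφ hψ hφψ hψφ hT h0
      fun n => (hr (u n)).symm] with x hx c
    have hE : (0 : 𝓔.IntegrableSection) x = 0 := rfl
    have hF : (0 : 𝓕.IntegrableSection) (φ x) = 0 := rfl
    simpa only [hE, hF, zero_sub, norm_neg] using hx c
  have hA (s : 𝓔.IntegrableSection) : ∀ᵐ x ∂μ, A x (s x) = r s (φ x) := by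
    filter_upwards [hest s, hML, hu] with x h1 h2 h3
    -- By density, `hest` extends from the vectors `L x c` to every `v` in the fiber; the choice `v
    -- = s x` makes the right-hand side vanish.
    have hcl : IsClosed {v | ‖r s (φ x) - A x v‖ ≤ ‖T‖ * ‖s x - v‖} :=
      isClosed_le (by fun_prop) (by fun_prop)
    have h := isClosed_property h3 hcl (fun c => by
      have : A x (L x c) = M x c := LinearMap.extendOfNorm_eq h3 ⟨_, h2⟩ c
      exact (this ▸ h1 c)) (s x)
    have h0 : ‖r s (φ x) - A x (s x)‖ ≤ 0 := by simpa using h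
    exact (sub_eq_zero.1 (norm_le_zero_iff.1 h0)).symm
  let Φ : BundlePremorphism 𝓔 𝓕 φ :=
    { toFun := fun v => ⟨φ v.1, A v.1 v.2⟩
      map_sections := fun s hs => by
        -- `T` acts only on integrable sections, so `s` is replaced by `s' = f s`, and the factor
        -- `f`, transported by `ψ`, is divided out of the image.
        obtain ⟨f, hfm, hf0, s', hs'⟩ := 𝓔.exists_pos_smul_integrable hs
        refine ⟨fun x => ((f (ψ x))⁻¹ : 𝕜) • r s' x, 𝓕.smul_mem _
          (RCLike.measurable_ofReal.comp (hfm.comp hψ.measurable)).inv _ (r s').mem, ?_⟩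
        filter_upwards [hA s', hψφ] with x h1 h2
        have h0 : (f x : 𝕜) ≠ 0 := by exact_mod_cast (hf0 x).ne'
        rw [h2, ← h1, hs', map_smul, inv_smul_smul₀ h0]
      fiberwise := .of_forall fun x => ⟨A x, fun v => rfl⟩
      bounded := ⟨‖T‖, by
        filter_upwards [hML, hu] with x h2 h3 v
        exact LinearMap.norm_extendOfNorm_apply_le h3 _ h2 v⟩ }
  refine ⟨Quotient.mk _ Φ, ContinuousLinearMap.ext fun s => ?_⟩
  obtain ⟨s, rfl⟩ := SeparationQuotient.surjective_mk s
  refine .trans ?_ (hr s)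
  refine GammaOne.mk_eq_mk.2 ?_
  filter_upwards [hψ.quasiMeasurePreserving.ae (hA s), hφψ] with x h1 h2
  refine BundlePremorphism.pushSection_eq _ ?_
  change (⟨φ (ψ x), A (ψ x) (s (ψ x))⟩ : Σ x, F x) = _
  rw [h1, h2]

end BundleMorphism

/-! ### Existence and uniqueness of the dynamical bundle -/

theorem mainTheorem11 {𝕜 : Type*} [RCLike 𝕜]
    {G : Type*} [Group G] [TopologicalSpace G] [DiscreteTopology G] (S : Submonoid G)
    {Ω : Type*} [MeasurableSpace Ω] (μ : Measure Ω) [SigmaFinite μ] [μ.IsComplete]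
    (φ : MeasurePreservingSystem G μ)
    {E : Ω → Type*} [∀ x, NormedAddCommGroup (E x)] [∀ x, NormedSpace 𝕜 (E x)]
    [∀ x, CompleteSpace (E x)]
    (𝓔 : MeasurableBanachBundle 𝕜 μ E) (h𝓔 : 𝓔.IsSeparable)
    (𝒯 : S →* (𝓔.GammaOne →L[𝕜] 𝓔.GammaOne))
    (h𝒯 : IsDynamicalBanachModule (φ.koopman 𝕜) S 𝒯) :
    ∃! Φ : DynamicalBanachBundle 𝓔 φ S, Φ.weightedKoopman = 𝒯 := by
  have hinv (g : G) : ∀ᵐ x ∂μ, φ g⁻¹ (φ g x) = x := by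
    simpa only [inv_inv] using φ.apply_inv g⁻¹
  have hinj (g : G) := BundleMorphism.weightedKoopman_injective (𝓕 := 𝓔) h𝓔
    (φ.measurePreserving g) (φ.measurePreserving g⁻¹) (φ.apply_inv g) (hinv g)
  -- Each `Φ g` is obtained separately; `koopman` is composition with `φ g⁻¹`, so `map_smul` is
  -- exactly the required semilinearity.
  choose Φ hΦ using fun g : S => BundleMorphism.exists_weightedKoopman_eq (𝓕 := 𝓔) h𝓔
    (φ.measurePreserving g) (φ.measurePreserving (g : G)⁻¹) (φ.apply_inv g) (hinv g) (𝒯 g)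
    (h𝒯.map_smul g)
  -- Injectivity turns both bundle identities and uniqueness into equalities of operators on
  -- `Γ¹(E)`.
  refine ⟨⟨Φ, hinj _ ?_, fun g h => hinj _ ?_⟩, MonoidHom.ext hΦ, fun Ψ hΨ => ?_⟩
  · exact ((hΦ 1).trans 𝒯.map_one).trans
      (BundleMorphism.weightedKoopman_id (φ.measurePreserving (1 : G)⁻¹) _ _).symm
  · refine ((hΦ (g * h)).trans (𝒯.map_mul g h)).trans (.symm ?_)
    rw [← hΦ g, ← hΦ h]
    refine BundleMorphism.weightedKoopman_comp _ _ _ _ _ _ _ _ ?_ _ _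
    simpa only [Submonoid.coe_mul, mul_inv_rev] using φ.map_mul (h : G)⁻¹ (g : G)⁻¹
  · ext g
    refine hinj _ (.trans ?_ (hΦ g).symm)
    exact DFunLike.congr_fun hΨ g
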